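/- Let $k$ be an algebraically closed field and let $X$ be a non-singular algebraic variety over $k$ (an integral separated scheme of finite type over $k$, with the Zariski topology, whose local rings at closed points are regular). Points are closed points, and subvarieties carry their reduced structure. An intersection $A\cap B$ of closed non-singular subvarieties is \emph{clean} if it is non-singular and $T_y(A\cap B)=T_yA\cap T_yB$ for every $y\in A\cap B$. Finitely many non-singular subvarieties $A_1,\dots,A_r$ intersect \emph{transversally} if at every $y\in A_1\cap\dots\cap A_r$ the annihilators $(T_yA_i)^\perp\subseteq (T_yX)^*$ form a direct sum. An \emph{arrangement of subvarieties} of $X$ is a finite set $\Lambda$ of (non-empty) non-singular closed connected subvarieties properly contained in $X$ such that for all $A,B\in\Lambda$ the intersection $A\cap B$ is either empty, or is a disjoint union of elements of $\Lambda$ and is clean; it is \emph{simple} if moreover each non-empty $A\cap B$ belongs to $\Lambda$. For an open $U\subseteq X$ and a set $\Sigma$ of subvarieties put $\Sigma|_U=\{A\cap U : A\in\Sigma,\ A\cap U\neq\emptyset\}$. If $\Lambda$ is simple, $\mathcal G\subseteq\Lambda$ is a \emph{building set} for $\Lambda$ if for every $L\in\Lambda\setminus\mathcal G$ the minimal elements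 (with respect to inclusion) of $\{G\in\mathcal G : L\subseteq G\}$, called the $\mathcal G$-factors of $L$, intersect transversally and have intersection $L$; a subset $\mathcal S\subseteq\mathcal G$ is then \emph{$\mathcal G$-nested} if every antichain (set of pairwise non-comparable elements with respect to inclusion) in $\mathcal S$ with at least two elements is the set of $\mathcal G$-factors of some element of $\Lambda\setminus\mathcal G$. For a general arrangement $\Lambda$, $\mathcal G\subseteq\Lambda$ is a \emph{building set} for $\Lambda$ if $X$ has an open cover $\mathcal U$ such that for every $U\in\mathcal U$ the restriction $\Lambda|_U$ is a simple arrangement of subvarieties of $U$ and $\mathcal G|_U$ is a building set for it. A subset $\mathcal S\subseteq\mathcal G$ is \emph{$\mathcal G$-nested} if there are such an open cover $\mathcal U$ and a $W\in\mathcal U$ such that $A\cap W\neq\emptyset$ for all $A\in\mathcal S$ and $\mathcal S|_W$ is $\mathcal G|_W$-nested. The building set $\mathcal G$ is \emph{well-connected} if, for every $\mathcal H\subseteq\mathcal G$ such that $\bigcap\mathcal H$ has two or more connected components, each of these components belongs to $\mathcal G$. \textbf{Proposition.} Let $\Lambda$ be an arrangement of subvarieties of $X$ and let $\mathcal G$ be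 a well-connected building set for $\Lambda$. A subset $\mathcal S\subseteq\mathcal G$ is $\mathcal G$-nested if and only if, for every antichain $\mathcal H\subseteq\mathcal S$ with at least two elements, the intersection $\bigcap\mathcal H$ is non-empty, connected, transversal, and does not belong to $\mathcal G$. -/

import Mathlib

open AlgebraicGeometry CategoryTheory TopologicalSpace

universe u

noncomputable section

namespace WonderfulArr

variable {X : Scheme.{u}}

/-! Varieties are schemes, subvarieties of `X` are (relatively) closed subsets of the underlying
space with their reduced structure, and the points of a variety are the closed points of the
scheme. All notions below are given for an open subset `U` of `X`, regarded as a variety of its own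
(the closed points of `U` are the closed points of `X` that lie in `U`); `U = ⊤` is `X` itself. -/

/-- The ideal `I_{Z,y}` of the reduced subvariety `Z` in the local ring `𝒪_{X,y}`: the germs at `y`
that vanish on `Z`, i.e. at all points of `Z` that specialize to `y` (these are the points of `Z`
in `Spec 𝒪_{X,y}`). Hence `𝒪_{Z,y} = 𝒪_{X,y} / I_{Z,y}`. -/
def stalkIdeal (Z : Set X) (y : X) : Ideal (X.presheaf.stalk y) :=
  PrimeSpectrum.vanishingIdeal (X.fromSpecStalk y ⁻¹' Z)

/-- `Z` is non-singular: the local ring `𝒪_{Z,y}` is regular for every closed point `y` of `Z`. -/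
def IsNonsingular (Z : Set X) : Prop :=
  ∀ y ∈ Z, IsClosed ({y} : Set X) → IsRegularLocalRing (X.presheaf.stalk y ⧸ stalkIdeal Z y)

/-- The residue field of `X` at `y`. -/
abbrev resField (y : X) : Type u := IsLocalRing.ResidueField (X.presheaf.stalk y)

/-- The Zariski cotangent space `𝔪_y / 𝔪_y²` of `X` at `y`. -/
abbrev cotangentSp (y : X) : Type u := IsLocalRing.CotangentSpace (X.presheaf.stalk y)

/-- The Zariski tangent space of `X` at `y`. -/
abbrev tangentSp (y : X) : Type u := Module.Dual (resField y) (cotangentSp y)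

/-- The conormal space of `Z` at `y`: the image of `I_{Z,y}` in `𝔪_y / 𝔪_y²`. -/
def conormalSpace (Z : Set X) (y : X) : Submodule (resField y) (cotangentSp y) :=
  Submodule.span _ ((IsLocalRing.maximalIdeal (X.presheaf.stalk y)).toCotangent ''
    {a | (a : X.presheaf.stalk y) ∈ stalkIdeal Z y})

/-- The tangent space `T_y Z`, as a subspace of `T_y X`: the tangent vectors that vanish on the
functions vanishing on `Z`. -/
def tangentSpace (Z : Set X) (y : X) : Submodule (resField y) (tangentSp y) :=
  (conormalSpace Z y).dualAnnihilator

/-- The intersection of `A` and `B` is clean: it is non-singular and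
`T_y (A ∩ B) = T_y A ∩ T_y B` at each of its points. -/
def IsCleanInter (A B : Set X) : Prop :=
  IsNonsingular (A ∩ B) ∧
    ∀ y ∈ A ∩ B, IsClosed ({y} : Set X) →
      tangentSpace (A ∩ B) y = tangentSpace A y ⊓ tangentSpace B y

/-- The members of `F` intersect transversally: at each point `y` of their intersection the
conormal spaces `(T_y A)^⊥`, `A ∈ F`, form a direct sum in the cotangent space (equivalently,
for finite `F`, the codimension of `⋂ T_y A` in `T_y X` is the sum of the codimensions
of the `T_y A`). -/
def IsTransversal (F : Set (Set X)) : Prop :=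
  ∀ y ∈ ⋂₀ F, IsClosed ({y} : Set X) → iSupIndep fun A : F => conormalSpace (A : Set X) y

/-- `L` is a non-singular closed connected subvariety of `U`, properly contained in `U`. -/
structure IsArrMember (U : X.Opens) (L : Set X) : Prop where
  closed_in : ∃ C : Set X, IsClosed C ∧ L = C ∩ U
  proper : L ≠ U
  connected : _root_.IsConnected L
  nonsingular : IsNonsingular L

/-- `Λ` is a simple arrangement of subvarieties of `U`. -/
structure IsSimpleArrangement (U : X.Opens) (Λ : Set (Set X)) : Prop where
  finite : Λ.Finite
  mem : ∀ L ∈ Λ, IsArrMember U L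
  inter : ∀ A ∈ Λ, ∀ B ∈ Λ, A ∩ B ∈ Λ ∨ A ∩ B = ∅
  clean : ∀ A ∈ Λ, ∀ B ∈ Λ, (A ∩ B).Nonempty → IsCleanInter A B

/-- `Λ` is an arrangement of subvarieties of `U`. -/
structure IsArrangement (U : X.Opens) (Λ : Set (Set X)) : Prop where
  finite : Λ.Finite
  mem : ∀ L ∈ Λ, IsArrMember U L
  inter : ∀ A ∈ Λ, ∀ B ∈ Λ,
    (∃ T ⊆ Λ, T.PairwiseDisjoint id ∧ A ∩ B = ⋃₀ T) ∨ A ∩ B = ∅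
  clean : ∀ A ∈ Λ, ∀ B ∈ Λ, (A ∩ B).Nonempty → IsCleanInter A B

/-- The restriction `Λ|_U` of a set of subvarieties to an open set. -/
def restr (Λ : Set (Set X)) (U : X.Opens) : Set (Set X) :=
  {M | ∃ L ∈ Λ, (L ∩ U).Nonempty ∧ M = L ∩ U}

/-- The minimal elements of `{G ∈ 𝒢 | L ⊆ G}`; for `L ∉ 𝒢` these are the `𝒢`-factors of `L`. -/
def factors (𝒢 : Set (Set X)) (L : Set X) : Set (Set X) :=
  {A | Minimal (fun G => G ∈ 𝒢 ∧ L ⊆ G) A}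

/-- `𝒢` is a building set for the simple arrangement `Λ`. -/
def IsSimpleBuilding (𝒢 Λ : Set (Set X)) : Prop :=
  𝒢 ⊆ Λ ∧ ∀ L ∈ Λ \ 𝒢, IsTransversal (factors 𝒢 L) ∧ ⋂₀ factors 𝒢 L = L

/-- `S` is `𝒢`-nested, for a building set `𝒢` of the simple arrangement `Λ`. -/
def IsSimpleNested (𝒢 Λ S : Set (Set X)) : Prop :=
  S ⊆ 𝒢 ∧ ∀ H ⊆ S, IsAntichain (· ⊆ ·) H → H.Nontrivial → ∃ L ∈ Λ \ 𝒢, factors 𝒢 L = H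

/-- `𝒰` is an open cover of `X` such that, on every `U ∈ 𝒰`, the arrangement `Λ` restricts to a
simple arrangement and `𝒢` to a building set for it. -/
def IsBuildingCover (𝒢 Λ : Set (Set X)) (𝒰 : Set X.Opens) : Prop :=
  sSup 𝒰 = ⊤ ∧
    ∀ U ∈ 𝒰, IsSimpleArrangement U (restr Λ U) ∧ IsSimpleBuilding (restr 𝒢 U) (restr Λ U)

/-- `𝒢` is a building set for the arrangement `Λ` of subvarieties of `X`. -/
def IsBuilding (𝒢 Λ : Set (Set X)) : Prop :=
  𝒢 ⊆ Λ ∧ ∃ 𝒰 : Set X.Opens, IsBuildingCover 𝒢 Λ 𝒰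

/-- `S` is `𝒢`-nested, for a building set `𝒢` of the arrangement `Λ`. -/
def IsNested (𝒢 Λ S : Set (Set X)) : Prop :=
  S ⊆ 𝒢 ∧ ∃ 𝒰 : Set X.Opens, IsBuildingCover 𝒢 Λ 𝒰 ∧
    ∃ W ∈ 𝒰, (∀ A ∈ S, (A ∩ W).Nonempty) ∧ IsSimpleNested (restr 𝒢 W) (restr Λ W) (restr S W)

/-- The set of connected components of a subset `Z`. -/
def components (Z : Set X) : Set (Set X) :=
  {C | ∃ x ∈ Z, C = connectedComponentIn Z x}

/-- Whenever an intersection of members of `𝒢` has two or more connected components, these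
components belong to `𝒢`. -/
def IsWellConnected (𝒢 : Set (Set X)) : Prop :=
  ∀ H ⊆ 𝒢, (components (⋂₀ H)).Nontrivial → components (⋂₀ H) ⊆ 𝒢

end WonderfulArr

end

/-! A connected non-singular closed set is irreducible, since its local rings are regular and hence
domains. So members of `Λ` are determined by their trace on any open set they meet, and what is
found on one chart of the cover carries over to `X` and to the other charts.

Let `S` be nested on a chart `W` and let `H` be an antichain in `S` with at least two elements. The
traces of `H` are the factors of `L = ⋂₀ H ∩ W`, which is not in `𝒢|_W`. Were `⋂₀ H` disconnected,
the component containing `L` would lie in `𝒢` by well-connectedness and have trace `L`. So `⋂₀ H` is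
a member of `Λ` outside `𝒢` with `H` among its factors, and the building condition on each chart
gives transversality there.

Conversely, the members of `S` have a common point; take a chart around it. For an antichain `H`
there with intersection `L`, the conormal spaces `N_f` of the factors `f` of `L` are independent,
while the `N_h`, `h ∈ H`, span that of `L` by cleanness. Each `h` contains some factor `φ h`, so
`N_f` is the sum of the `N_h` with `φ h = f` (`iSupIndep.le_iSup_fiber`). Non-singular irreducible
subvarieties, one inside the other, with equal conormal spaces at a point coincide
(`eq_of_conormalSpace_le`), so `f` is the intersection of its fibre. The criterion forces that fibre
to be a singleton, and `H` is the set of factors. -/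

namespace IsRegularLocalRing

/-! ### Regular local rings and their regular quotients -/

open IsLocalRing

/-- An element of `𝔪 \ 𝔪²` is part of a minimal system of generators of `𝔪`. -/
lemma spanFinrank_maximalIdeal_quotient_add_one_le {R : Type*} [CommRing R] [IsLocalRing R]
    [IsNoetherianRing R] {x : R} (hx : x ∈ maximalIdeal R) (hx2 : x ∉ maximalIdeal R ^ 2)
    [IsLocalRing (R ⧸ Ideal.span {x})] :
    (maximalIdeal (R ⧸ Ideal.span {x})).spanFinrank + 1 ≤ (maximalIdeal R).spanFinrank := by
  classical
  obtain ⟨s, hcard, hs⟩ := Submodule.FG.exists_span_finset_card_eq_spanFinrank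
    (maximalIdeal R).fg_of_isNoetherianRing
  have hsm : ∀ i ∈ s, i ∈ maximalIdeal R := fun i hi => hs ▸ Submodule.subset_span hi
  have hx' := hx
  rw [← hs, Submodule.mem_span_finset] at hx'
  obtain ⟨a, -, ha⟩ := hx'
  -- A generator with unit coefficient in `x` becomes redundant modulo `x`.
  obtain ⟨i, hi, hai⟩ : ∃ i ∈ s, a i ∉ maximalIdeal R := by
    by_contra! h
    refine hx2 (ha ▸ Ideal.sum_mem _ fun i hi => ?_)
    rw [pow_two, smul_eq_mul]
    exact Ideal.mul_mem_mul (h i hi) (hsm i hi)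
  have hu : IsUnit (a i) := by simpa using hai
  let q := Ideal.Quotient.mk (Ideal.span {x})
  have hq : q i ∈ Ideal.span (q '' (s.erase i : Finset R)) := by
    have h0 : q (a i) * q i + ∑ j ∈ s.erase i, q (a j) * q j = 0 := by
      have : q x = 0 := Ideal.Quotient.eq_zero_iff_mem.2 (Ideal.mem_span_singleton_self x)
      rw [← this]
      conv_rhs => rw [show q x = q (∑ j ∈ s, a j • j) by rw [ha], ← Finset.add_sum_erase s _ hi]
      simp
    rw [← (hu.map q).unit_spec] at h0
    have h1 : q i = ((hu.map q).unit⁻¹ : (R ⧸ Ideal.span {x})ˣ) *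
        (- ∑ j ∈ s.erase i, q (a j) * q j) := by
      rw [← eq_neg_of_add_eq_zero_left h0, ← mul_assoc, Units.inv_mul, one_mul]
    rw [h1]
    refine Ideal.mul_mem_left _ _ (neg_mem (Ideal.sum_mem _ fun j hj => ?_))
    exact Ideal.mul_mem_left _ _ (Ideal.subset_span ⟨j, hj, rfl⟩)
  have hmap : maximalIdeal (R ⧸ Ideal.span {x}) = Ideal.span (q '' (s.erase i : Finset R)) := by
    have h1 : maximalIdeal (R ⧸ Ideal.span {x}) = (maximalIdeal R).map q := by
      have : IsLocalHom q := IsLocalHom.of_surjective q Ideal.Quotient.mk_surjective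
      have h2 : (maximalIdeal (R ⧸ Ideal.span {x})).comap q = maximalIdeal R :=
        ((local_hom_TFAE q).out 0 4).1 this
      rw [← h2, Ideal.map_comap_of_surjective q Ideal.Quotient.mk_surjective]
    rw [h1, ← hs]
    change Ideal.map q (Ideal.span _) = _
    rw [Ideal.map_span]
    refine le_antisymm (Ideal.span_le.2 ?_) (Ideal.span_mono (Set.image_mono (by simp)))
    rintro _ ⟨j, hj, rfl⟩
    by_cases hji : j = i
    · exact hji ▸ hq
    · exact Ideal.subset_span ⟨j, Finset.mem_coe.2 (Finset.mem_erase.2 ⟨hji, hj⟩), rfl⟩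
  rw [hmap, ← hcard, ← Finset.card_erase_add_one hi]
  refine Nat.add_le_add_right ?_ 1
  refine (Submodule.spanFinrank_span_le_ncard_of_finite ((Finset.finite_toSet _).image _)).trans ?_
  exact (Set.ncard_image_le (Finset.finite_toSet _)).trans (Set.ncard_coe_finset _).le

/-- A regular local ring is a domain. -/
theorem isDomain (R : Type*) [CommRing R] [hR : IsRegularLocalRing R] : IsDomain R := by
  obtain ⟨n, hn⟩ : ∃ n, (maximalIdeal R).spanFinrank = n := ⟨_, rfl⟩
  induction n generalizing R with
  | zero =>
    have h0 : maximalIdeal R = ⊥ :=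
      (Submodule.spanFinrank_eq_zero_iff_eq_bot (maximalIdeal R).fg_of_isNoetherianRing).1 hn
    exact (isField_iff_maximalIdeal_eq.2 h0).isDomain
  | succ n ih =>
    have hdim : ringKrullDim R = (n + 1 : ℕ) := by rw [← spanFinrank_maximalIdeal, hn]
    have hm2 : ¬ maximalIdeal R ≤ maximalIdeal R ^ 2 := by
      intro h
      have : maximalIdeal R = ⊥ := Submodule.eq_bot_of_le_smul_of_le_jacobson_bot (maximalIdeal R) _
        (maximalIdeal R).fg_of_isNoetherianRing (by rwa [smul_eq_mul, ← pow_two])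
        (jacobson_eq_maximalIdeal _ bot_ne_top).ge
      rw [this, Submodule.spanFinrank_bot] at hn
      omega
    have hmin : maximalIdeal R ∉ minimalPrimes R := by
      intro h
      have h0 : (maximalIdeal R).height = 0 := Ideal.height_eq_zero_iff.2 h
      have := maximalIdeal_height_eq_ringKrullDim (R := R)
      rw [h0, hdim] at this
      norm_cast at this
    obtain ⟨x, hxm, hx⟩ : ∃ x ∈ maximalIdeal R,
        ∀ I ∈ insert (maximalIdeal R ^ 2) (minimalPrimes R), x ∉ I := by
      by_contra! h
      -- Prime avoidance tolerates two non-prime ideals; `𝔪²` fills both slots.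
      have := (Ideal.subset_union_prime_finite
        ((minimalPrimes.finite_of_isNoetherianRing R).insert (maximalIdeal R ^ 2)) (f := id)
        (I := maximalIdeal R) (maximalIdeal R ^ 2) (maximalIdeal R ^ 2) (by
          rintro I (rfl | hI) h1 -
          · exact absurd rfl h1
          · exact hI.1.1)).1 (by
          intro x hx
          obtain ⟨I, hI, hxI⟩ := h x hx
          exact Set.mem_biUnion hI hxI)
      obtain ⟨I, rfl | hI, hle⟩ := this
      · exact hm2 hle
      · have hI' : I.IsPrime := hI.1.1
        rw [show id I = I from rfl] at hle
        rw [← (maximalIdeal.isMaximal R).eq_of_le hI'.ne_top hle] at hI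
        exact hmin hI
    have hnt : Nontrivial (R ⧸ Ideal.span {x}) := Ideal.Quotient.nontrivial_iff.2 fun h =>
      (maximalIdeal.isMaximal R).ne_top
        (top_le_iff.1 (h ▸ (Ideal.span_singleton_le_iff_mem _).2 hxm))
    have hloc : IsLocalRing (R ⧸ Ideal.span {x}) :=
      IsLocalRing.of_surjective' (Ideal.Quotient.mk (Ideal.span {x})) Ideal.Quotient.mk_surjective
    have hle := spanFinrank_maximalIdeal_quotient_add_one_le hxm (hx _ (Set.mem_insert _ _))
    have hdimq : ((maximalIdeal R).height : WithBot ℕ∞) ≤ _ :=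
      Ideal.height_le_ringKrullDim_quotient_add_one hxm
    rw [maximalIdeal_height_eq_ringKrullDim, hdim] at hdimq
    have hdimq' : (n : WithBot ℕ∞) ≤ ringKrullDim (R ⧸ Ideal.span {x}) := by
      rw [Nat.cast_add, Nat.cast_one] at hdimq
      exact ENat.WithBot.add_le_add_one_right_iff.1 hdimq
    have hreg : IsRegularLocalRing (R ⧸ Ideal.span {x}) :=
      of_spanFinrank_maximalIdeal_le _ (le_trans (by exact_mod_cast (by omega)) hdimq')
    have hrank : (maximalIdeal (R ⧸ Ideal.span {x})).spanFinrank = n := by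
      have : (n : WithBot ℕ∞) ≤ ((maximalIdeal (R ⧸ Ideal.span {x})).spanFinrank : ℕ) := by
        rwa [hreg.spanFinrank_maximalIdeal]
      have : n ≤ (maximalIdeal (R ⧸ Ideal.span {x})).spanFinrank := by exact_mod_cast this
      omega
    have hdom := ih (R ⧸ Ideal.span {x}) hrank
    have hprime : (Ideal.span {x}).IsPrime := (Ideal.Quotient.isDomain_iff_prime _).1 hdom
    obtain ⟨p, hp, hpx⟩ := Ideal.exists_minimalPrimes_le (J := Ideal.span {x}) bot_le
    have hxp : x ∉ p := hx p (Set.mem_insert_of_mem _ hp)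
    have hpp : p.IsPrime := hp.1.1
    -- Since `p ⊆ (x)` and `x ∉ p`, every element of `p` is `x` times an element of `p`; Nakayama
    -- applies.
    have hp0 : p = ⊥ := by
      refine Submodule.eq_bot_of_le_smul_of_le_jacobson_bot (maximalIdeal R) _
        p.fg_of_isNoetherianRing (fun a ha => ?_) (jacobson_eq_maximalIdeal _ bot_ne_top).ge
      obtain ⟨b, rfl⟩ := Ideal.mem_span_singleton'.1 (hpx ha)
      rw [mul_comm, smul_eq_mul]
      exact Ideal.mul_mem_mul hxm ((hpp.mem_or_mem ha).resolve_right hxp)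
    rw [hp0] at hpp
    exact IsDomain.of_bot_isPrime R

/-- A regular quotient of a regular local ring by an ideal contained in `𝔪²` is trivial. -/
theorem eq_bot_of_le_maximalIdeal_sq {R : Type*} [CommRing R] [IsRegularLocalRing R]
    {I : Ideal R} (hI : I ≤ maximalIdeal R ^ 2) [hreg : IsRegularLocalRing (R ⧸ I)] : I = ⊥ := by
  classical
  have := isDomain R
  let q := Ideal.Quotient.mk I
  have hqs : Function.Surjective q := Ideal.Quotient.mk_surjective
  obtain ⟨s, hcard, hs⟩ := Submodule.FG.exists_span_finset_card_eq_spanFinrank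
    (maximalIdeal (R ⧸ I)).fg_of_isNoetherianRing
  have hcm : (maximalIdeal (R ⧸ I)).comap q = maximalIdeal R := by
    have : IsLocalHom q := IsLocalHom.of_surjective q hqs
    exact ((local_hom_TFAE q).out 0 4).1 this
  let g := Function.surjInv hqs
  have hg : ∀ b, q (g b) = b := Function.surjInv_eq hqs
  -- As `I ⊆ 𝔪²`, lifts of generators of `𝔪 / I` generate `𝔪` by Nakayama. Hence `dim R ≤ dim R ⧸
  -- I`, whereas a nonzero element of `I` would lower the dimension of the domain `R`.
  have hspan : maximalIdeal R = Ideal.span (g '' s) := by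
    have hle : Ideal.span (g '' s) ≤ maximalIdeal R := by
      rw [Ideal.span_le, ← hcm]
      rintro _ ⟨b, hb, rfl⟩
      change q (g b) ∈ maximalIdeal (R ⧸ I)
      rw [hg, ← hs]
      exact Submodule.subset_span hb
    refine le_antisymm ?_ hle
    refine Submodule.le_of_le_smul_of_le_jacobson_bot (I := maximalIdeal R)
      (maximalIdeal R).fg_of_isNoetherianRing (jacobson_eq_maximalIdeal _ bot_ne_top).ge ?_
    rw [smul_eq_mul, ← pow_two]
    refine le_trans ?_ (sup_le_sup_left hI _)
    have hmap : (Ideal.span (g '' s)).map q = maximalIdeal (R ⧸ I) := by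
      rw [Ideal.map_span, ← Set.image_comp, show q ∘ g = id from funext hg, Set.image_id]
      exact hs
    conv_lhs => rw [← hcm, ← hmap, Ideal.comap_map_of_surjective' _ hqs, Ideal.mk_ker]
  have h1 : (maximalIdeal R).spanFinrank ≤ (maximalIdeal (R ⧸ I)).spanFinrank := by
    rw [hspan, ← hcard]
    refine (Submodule.spanFinrank_span_le_ncard_of_finite ((Finset.finite_toSet _).image _)).trans ?_
    exact (Set.ncard_image_le (Finset.finite_toSet _)).trans (Set.ncard_coe_finset _).le
  have hdim : ringKrullDim R ≤ ringKrullDim (R ⧸ I) := by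
    rw [← spanFinrank_maximalIdeal, ← spanFinrank_maximalIdeal]
    exact_mod_cast h1
  by_contra hne
  obtain ⟨r, hr, hr0⟩ := Submodule.exists_mem_ne_zero_of_ne_bot hne
  have h2 := ringKrullDim_quotient_succ_le_of_nonZeroDivisor (mem_nonZeroDivisors_of_ne_zero hr0)
  have h3 : ringKrullDim (R ⧸ I) ≤ ringKrullDim (R ⧸ Ideal.span {r}) :=
    ringKrullDim_le_of_surjective
      (Ideal.Quotient.factor ((Ideal.span_singleton_le_iff_mem _).2 hr))
      (Ideal.Quotient.factor_surjective _)
  have h4 : ringKrullDim R + 1 ≤ ringKrullDim R :=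
    le_trans (add_le_add_left (hdim.trans h3) 1) h2
  rw [← spanFinrank_maximalIdeal] at h4
  norm_cast at h4
  omega

/-- Two regular quotients `R ⧸ J → R ⧸ I` of a local ring agree once `I ⊆ J + 𝔪²`. -/
theorem eq_of_le_sup_maximalIdeal_sq {R : Type*} [CommRing R] [IsLocalRing R] {I J : Ideal R}
    (hJI : J ≤ I) (h : I ≤ J ⊔ maximalIdeal R ^ 2) [hJ : IsRegularLocalRing (R ⧸ J)]
    [hI : IsRegularLocalRing (R ⧸ I)] : I = J := by
  let q := Ideal.Quotient.mk J
  have hqs : Function.Surjective q := Ideal.Quotient.mk_surjective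
  have : IsLocalHom q := IsLocalHom.of_surjective q hqs
  have hle : I.map q ≤ maximalIdeal (R ⧸ J) ^ 2 := by
    refine (Ideal.map_mono h).trans ?_
    rw [Ideal.map_sup, Ideal.map_quotient_self, bot_sup_eq, Ideal.map_pow]
    exact Ideal.pow_right_mono (((local_hom_TFAE q).out 0 2).1 this) 2
  have hreg : IsRegularLocalRing ((R ⧸ J) ⧸ I.map q) :=
    of_ringEquiv (DoubleQuot.quotQuotEquivQuotOfLE hJI).symm
  have h0 := eq_bot_of_le_maximalIdeal_sq hle
  refine le_antisymm (fun a ha => ?_) hJI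
  have : q a ∈ I.map q := Ideal.mem_map_of_mem q ha
  rw [h0] at this
  exact Ideal.Quotient.eq_zero_iff_mem.1 this

end IsRegularLocalRing

namespace WonderfulArr

variable {X : Scheme.{u}}

/-! ### Stalk ideals and conormal spaces -/

lemma fromSpecStalk_specializes (y : X) (z : Spec (X.presheaf.stalk y)) :
    X.fromSpecStalk y z ⤳ y := by
  have : X.fromSpecStalk y z ∈ Set.range (X.fromSpecStalk y) := ⟨z, rfl⟩
  rwa [Scheme.range_fromSpecStalk] at this

lemma exists_fromSpecStalk_eq {y z : X} (h : z ⤳ y) : ∃ w, X.fromSpecStalk y w = z := by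
  have : z ∈ Set.range (X.fromSpecStalk y) := by rwa [Scheme.range_fromSpecStalk]
  exact this

/-- The points of `Spec 𝒪_{X,y}` are the generizations of `y`, and these all lie in `U`. -/
lemma stalkIdeal_inter_open (Z : Set X) (U : X.Opens) {y : X} (hy : y ∈ U) :
    stalkIdeal (Z ∩ U) y = stalkIdeal Z y := by
  unfold stalkIdeal
  congr 1
  ext z
  exact and_iff_left ((fromSpecStalk_specializes y z).mem_open U.2 hy)

lemma conormalSpace_inter_open (Z : Set X) (U : X.Opens) {y : X} (hy : y ∈ U) :
    conormalSpace (Z ∩ U) y = conormalSpace Z y := by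
  simp only [conormalSpace, stalkIdeal_inter_open Z U hy]

lemma stalkIdeal_anti {A B : Set X} (h : A ⊆ B) (y : X) : stalkIdeal B y ≤ stalkIdeal A y :=
  PrimeSpectrum.vanishingIdeal_anti_mono (Set.preimage_mono h)

lemma conormalSpace_anti {A B : Set X} (h : A ⊆ B) (y : X) :
    conormalSpace B y ≤ conormalSpace A y :=
  Submodule.span_mono (Set.image_mono fun _ ha => stalkIdeal_anti h y ha)

lemma stalkIdeal_le_maximalIdeal {Z : Set X} {y : X} (hy : y ∈ Z) :
    stalkIdeal Z y ≤ IsLocalRing.maximalIdeal (X.presheaf.stalk y) := by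
  have : ({IsLocalRing.closedPoint (X.presheaf.stalk y)} : Set _) ⊆ X.fromSpecStalk y ⁻¹' Z := by
    rintro _ rfl
    change X.fromSpecStalk y _ ∈ Z
    rwa [Scheme.fromSpecStalk_closedPoint]
  refine (PrimeSpectrum.vanishingIdeal_anti_mono this).trans ?_
  rw [PrimeSpectrum.vanishingIdeal_singleton]
  rfl

lemma mem_of_stalkIdeal_le {A B : Set X} {y z : X} (hA : IsClosed A)
    (h : stalkIdeal A y ≤ stalkIdeal B y) (hz : z ⤳ y) (hzB : z ∈ B) : z ∈ A := by
  obtain ⟨w, rfl⟩ := exists_fromSpecStalk_eq hz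
  have hcl : IsClosed (X.fromSpecStalk y ⁻¹' A) := hA.preimage (X.fromSpecStalk y).continuous
  have hw : w ∈ PrimeSpectrum.zeroLocus (stalkIdeal A y : Set (X.presheaf.stalk y)) := by
    refine PrimeSpectrum.zeroLocus_anti_mono h ?_
    exact PrimeSpectrum.subset_zeroLocus_vanishingIdeal _ hzB
  rw [stalkIdeal, PrimeSpectrum.zeroLocus_vanishingIdeal_eq_closure] at hw
  exact hcl.closure_subset hw

lemma stalkIdeal_le_sup_of_conormalSpace_le {A B : Set X} {y : X} (hy : y ∈ A)
    (h : conormalSpace A y ≤ conormalSpace B y) :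
    stalkIdeal A y ≤ stalkIdeal B y ⊔ IsLocalRing.maximalIdeal (X.presheaf.stalk y) ^ 2 := by
  intro a ha
  let a' : IsLocalRing.maximalIdeal (X.presheaf.stalk y) := ⟨a, stalkIdeal_le_maximalIdeal hy ha⟩
  have h1 : (IsLocalRing.maximalIdeal (X.presheaf.stalk y)).toCotangent a' ∈ conormalSpace B y :=
    h (Submodule.subset_span ⟨a', ha, rfl⟩)
  -- The image of the ideal is already a subspace, because scalars of the residue field lift to the
  -- stalk.
  have h2 : ∃ b : IsLocalRing.maximalIdeal (X.presheaf.stalk y), (b : X.presheaf.stalk y) ∈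
      stalkIdeal B y ∧ (IsLocalRing.maximalIdeal (X.presheaf.stalk y)).toCotangent b =
        (IsLocalRing.maximalIdeal (X.presheaf.stalk y)).toCotangent a' := by
    refine Submodule.span_induction (p := fun v _ => ∃ b : IsLocalRing.maximalIdeal
      (X.presheaf.stalk y), (b : X.presheaf.stalk y) ∈ stalkIdeal B y ∧
      (IsLocalRing.maximalIdeal (X.presheaf.stalk y)).toCotangent b = v) ?_ ?_ ?_ ?_ h1
    · rintro _ ⟨b, hb, rfl⟩
      exact ⟨b, hb, rfl⟩
    · exact ⟨0, zero_mem _, map_zero _⟩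
    · rintro _ _ - - ⟨b, hb, rfl⟩ ⟨c, hc, rfl⟩
      exact ⟨b + c, add_mem hb hc, map_add _ _ _⟩
    · rintro r _ - ⟨b, hb, rfl⟩
      obtain ⟨r, rfl⟩ := IsLocalRing.residue_surjective r
      refine ⟨r • b, Ideal.mul_mem_left _ _ hb, ?_⟩
      rw [map_smul]
      exact (algebraMap_smul (IsLocalRing.ResidueField (X.presheaf.stalk y)) r _).symm
  obtain ⟨b, hb, hba⟩ := h2
  rw [Ideal.toCotangent_eq] at hba
  have : a = b + -(b - a) := by ring
  rw [this]
  exact Submodule.add_mem_sup hb (neg_mem hba)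

/-- Non-singular subvarieties `A ⊆ B` with the same conormal space at a point of `A` coincide. -/
lemma eq_of_conormalSpace_le {A B : Set X} {y : X} (hy : IsClosed ({y} : Set X)) (hyA : y ∈ A)
    (hAB : A ⊆ B) (hA : IsClosed A) (hB : IsClosed B) (hBi : IsIrreducible B)
    (hAn : IsNonsingular A) (hBn : IsNonsingular B)
    (h : conormalSpace A y ≤ conormalSpace B y) : A = B := by
  have := hAn y hyA hy
  have := hBn y (hAB hyA) hy
  have hI : stalkIdeal A y = stalkIdeal B y :=
    IsRegularLocalRing.eq_of_le_sup_maximalIdeal_sq (stalkIdeal_anti hAB y)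
      (stalkIdeal_le_sup_of_conormalSpace_le hyA h)
  -- The generic point of `B` specializes to `y`, so equality of the ideals at `y` already decides
  -- whether it lies in `A`.
  obtain ⟨η, hη⟩ := QuasiSober.sober hBi hB
  have hηA : η ∈ A := mem_of_stalkIdeal_le hA hI.le (hη.specializes (hAB hyA)) hη.mem
  refine hAB.antisymm ?_
  rw [← hη.def]
  exact closure_minimal (by simpa using hηA) hA

lemma isNonsingular_univ [IsIntegral X]
    (hX : ∀ y : X, IsClosed ({y} : Set X) → IsRegularLocalRing (X.presheaf.stalk y)) :
    IsNonsingular (Set.univ : Set X) := by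
  intro y _ hy
  have h0 : stalkIdeal (Set.univ : Set X) y = ⊥ := by
    change PrimeSpectrum.vanishingIdeal (Set.univ : Set (PrimeSpectrum _)) = ⊥
    rw [PrimeSpectrum.vanishingIdeal_univ, nilradical_eq_zero]
    rfl
  have := hX y hy
  rw [h0]
  exact IsRegularLocalRing.of_ringEquiv (RingEquiv.quotientBot _).symm

/-- This is `eq_of_conormalSpace_le` with `B = X`: a zero conormal space would force `A = X`. -/
lemma conormalSpace_ne_bot [IsIntegral X]
    (hX : ∀ y : X, IsClosed ({y} : Set X) → IsRegularLocalRing (X.presheaf.stalk y))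
    {A : Set X} {y : X} (hy : IsClosed ({y} : Set X)) (hyA : y ∈ A) (hA : IsClosed A)
    (hAn : IsNonsingular A) (hne : A ≠ Set.univ) : conormalSpace A y ≠ ⊥ := by
  intro h
  exact hne (eq_of_conormalSpace_le hy hyA (Set.subset_univ A) hA isClosed_univ
    (IrreducibleSpace.isIrreducible_univ X) hAn (isNonsingular_univ hX) (h ▸ bot_le))

/-! ### Connected non-singular subvarieties are irreducible -/

/-- Irreducible closed subsets of a non-singular closed `Z` that meet lie in a common one. -/
lemma exists_isIrreducible_superset [JacobsonSpace X] {Z A B : Set X} (hZ : IsClosed Z)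
    (hn : IsNonsingular Z) (hA : IsClosed A) (hB : IsClosed B) (hAi : IsIrreducible A)
    (hBi : IsIrreducible B) (hAZ : A ⊆ Z) (hBZ : B ⊆ Z) (hAB : (A ∩ B).Nonempty) :
    ∃ C ⊆ Z, IsIrreducible C ∧ A ⊆ C ∧ B ⊆ C := by
  obtain ⟨y, ⟨hyA, hyB⟩, hy⟩ := nonempty_inter_closedPoints hAB (hA.inter hB).isLocallyClosed
  have := hn y (hAZ hyA) hy
  have hdom := IsRegularLocalRing.isDomain (X.presheaf.stalk y ⧸ stalkIdeal Z y)
  have hp : (stalkIdeal Z y).IsPrime := (Ideal.Quotient.isDomain_iff_prime _).1 hdom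
  -- The generizations of `y` in `Z` form an irreducible set; its closure contains every irreducible
  -- closed subset of `Z` through `y`, having its generic point.
  have hirr := PrimeSpectrum.isIrreducible_iff_vanishingIdeal_isPrime.2 hp
  have himg := hirr.image (X.fromSpecStalk y) (X.fromSpecStalk y).continuous.continuousOn
  have hsub : ∀ {D : Set X}, IsClosed D → IsIrreducible D → D ⊆ Z → y ∈ D →
      D ⊆ closure (X.fromSpecStalk y '' (X.fromSpecStalk y ⁻¹' Z)) := by
    intro D hD hDi hDZ hyD
    obtain ⟨η, hη⟩ := QuasiSober.sober hDi hD
    obtain ⟨w, hw⟩ := exists_fromSpecStalk_eq (hη.specializes hyD)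
    rw [← hη.def]
    refine closure_mono ?_
    rintro _ rfl
    exact ⟨w, by simpa [hw] using hDZ hη.mem, hw⟩
  exact ⟨_, closure_minimal (Set.image_preimage_subset _ _) hZ, himg.closure,
    hsub hA hAi hAZ hyA, hsub hB hBi hBZ hyB⟩

/-- A connected non-singular closed subvariety is irreducible. -/
lemma IsNonsingular.isIrreducible [JacobsonSpace X] [NoetherianSpace X] {Z : Set X}
    (hn : IsNonsingular Z) (hZ : IsClosed Z) (hc : _root_.IsConnected Z) : IsIrreducible Z := by
  obtain ⟨S, hSf, hScl, hSi, hSZ⟩ :=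
    NoetherianSpace.exists_finite_set_isClosed_irreducible hZ
  have hsub : ∀ t ∈ S, t ⊆ Z := fun t ht => hSZ ▸ Set.subset_sUnion_of_mem ht
  have hSne : S.Nonempty := by
    obtain ⟨x, hx⟩ := hc.nonempty
    rw [hSZ] at hx
    obtain ⟨t, ht, -⟩ := hx
    exact ⟨t, ht⟩
  obtain ⟨M, hM⟩ := hSf.exists_maximal hSne
  have hkey : ∀ t ∈ S, (M ∩ t).Nonempty → t ⊆ M := by
    intro t ht hMt
    obtain ⟨C, hCZ, hCi, hMC, htC⟩ := exists_isIrreducible_superset hZ hn (hScl M hM.1)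
      (hScl t ht) (hSi M hM.1) (hSi t ht) (hsub M hM.1) (hsub t ht) hMt
    obtain ⟨t', ht', hCt'⟩ := isIrreducible_iff_sUnion_isClosed.1 hCi hSf.toFinset
      (fun z hz => hScl z (by simpa using hz)) (by simpa [← hSZ] using hCZ)
    exact htC.trans (hCt'.trans (hM.2 (by simpa using ht') (hMC.trans hCt')))
  -- `M` and `N` are disjoint closed sets covering the connected `Z`, so `N` contributes nothing.
  let N : Set X := ⋃₀ {t ∈ S | ¬ t ⊆ M}
  have hNcl : IsClosed N := by
    rw [show N = _ from Set.sUnion_eq_biUnion]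
    exact (hSf.subset (Set.sep_subset _ _)).isClosed_biUnion fun t ht => hScl t ht.1
  have hcov : Z ⊆ M ∪ N := by
    intro x hx
    rw [hSZ] at hx
    obtain ⟨t, ht, hxt⟩ := hx
    by_cases h : t ⊆ M
    · exact Or.inl (h hxt)
    · exact Or.inr ⟨t, ⟨ht, h⟩, hxt⟩
  have hdisj : Z ∩ (M ∩ N) = ∅ := by
    rw [Set.eq_empty_iff_forall_notMem]
    rintro x ⟨-, hxM, t, ⟨ht, htM⟩, hxt⟩
    exact htM (hkey t ht ⟨x, hxM, hxt⟩)
  rcases (isPreconnected_iff_subset_of_disjoint_closed.1 hc.isPreconnected) M N (hScl M hM.1) hNcl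
    hcov hdisj with h | h
  · rw [h.antisymm (hsub M hM.1)]
    exact hSi M hM.1
  · obtain ⟨x, hx⟩ := (hSi M hM.1).nonempty
    exact (Set.eq_empty_iff_forall_notMem.1 hdisj x
      ⟨hsub M hM.1 hx, hx, h (hsub M hM.1 hx)⟩).elim

end WonderfulArr

/-! ### Independent families and irreducible sets -/

/-- Components of an independent family are covered by the elements lying below them, if these
elements span. -/
lemma iSupIndep.le_iSup_fiber {α ι κ : Type*} [CompleteLattice α] [IsModularLattice α]
    {N : ι → α} (hN : iSupIndep N) (φ : κ → ι) {n : κ → α} (hn : ∀ h, n h ≤ N (φ h)) {f : ι}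
    (hf : N f ≤ ⨆ h, n h) : N f ≤ ⨆ (h) (_ : φ h = f), n h := by
  have hP : ⨆ (h) (_ : φ h = f), n h ≤ N f := iSup₂_le fun h hh => hh ▸ hn h
  have hQ : ⨆ h, n h ≤ (⨆ (h) (_ : φ h = f), n h) ⊔ ⨆ (j) (_ : j ≠ f), N j := by
    refine iSup_le fun h => ?_
    by_cases hh : φ h = f
    · exact le_sup_of_le_left (le_iSup₂_of_le h hh le_rfl)
    · exact le_sup_of_le_right (le_iSup₂_of_le (φ h) hh (hn h))
  -- The modular law, with `N f` disjoint from the join of the other `N j`.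
  calc N f = ((⨆ (h) (_ : φ h = f), n h) ⊔ ⨆ (j) (_ : j ≠ f), N j) ⊓ N f :=
        (inf_eq_right.2 (hf.trans hQ)).symm
    _ = (⨆ (h) (_ : φ h = f), n h) ⊔ (⨆ (j) (_ : j ≠ f), N j) ⊓ N f :=
        sup_inf_assoc_of_le _ hP
    _ ≤ _ := by rw [inf_comm, (hN f).eq_bot, sup_bot_eq]

lemma IsIrreducible.subset_of_inter_subset {α : Type*} [TopologicalSpace α] {A B U : Set α}
    (hA : IsIrreducible A) (hB : IsClosed B) (hU : IsOpen U) (hne : (A ∩ U).Nonempty)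
    (h : A ∩ U ⊆ B) : A ⊆ B := by
  rcases isPreirreducible_iff_isClosed_union_isClosed.1 hA.isPreirreducible B Uᶜ hB
    hU.isClosed_compl (fun x hx => by
      by_cases hxU : x ∈ U
      · exact Or.inl (h ⟨hx, hxU⟩)
      · exact Or.inr hxU) with h1 | h1
  · exact h1
  · obtain ⟨x, hxA, hxU⟩ := hne
    exact absurd hxU (h1 hxA)

namespace WonderfulArr

variable {X : Scheme.{u}}

/-! ### Intersections in arrangements -/

lemma IsArrMember.isClosed {L : Set X} (h : IsArrMember ⊤ L) : IsClosed L := by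
  obtain ⟨C, hC, rfl⟩ := h.closed_in
  simpa using hC

lemma IsArrMember.ne_univ {L : Set X} (h : IsArrMember ⊤ L) : L ≠ Set.univ := by
  simpa using h.proper

/-- Dual annihilators turn sums into intersections and determine the subspace, so cleanness is
additivity of conormal spaces. -/
lemma IsCleanInter.conormalSpace_eq {A B : Set X} (h : IsCleanInter A B) {y : X}
    (hy : y ∈ A ∩ B) (hyc : IsClosed ({y} : Set X)) :
    conormalSpace (A ∩ B) y = conormalSpace A y ⊔ conormalSpace B y := by
  have := h.2 y hy hyc
  rw [tangentSpace, tangentSpace, tangentSpace, ← Submodule.dualAnnihilator_sup_eq] at this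
  exact Subspace.dualAnnihilator_inj.1 this

/-- The extra member `A` starts the induction, since the empty intersection is all of `X`, which is
not a member. -/
lemma IsSimpleArrangement.inter_sInter {U : X.Opens} {Λ : Set (Set X)}
    (hΛ : IsSimpleArrangement U Λ) {T : Set (Set X)} (hT : T.Finite) (hTΛ : T ⊆ Λ) {A : Set X}
    (hA : A ∈ Λ) (hne : (A ∩ ⋂₀ T).Nonempty) :
    A ∩ ⋂₀ T ∈ Λ ∧ ∀ y ∈ A ∩ ⋂₀ T, IsClosed ({y} : Set X) →
      conormalSpace (A ∩ ⋂₀ T) y = conormalSpace A y ⊔ ⨆ B ∈ T, conormalSpace B y := by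
  induction T, hT using Set.Finite.induction_on with
  | empty => simpa using hA
  | @insert B T _ _ ih =>
    rw [Set.insert_subset_iff] at hTΛ
    have heq : A ∩ ⋂₀ insert B T = (A ∩ ⋂₀ T) ∩ B := by
      rw [Set.sInter_insert]
      ac_rfl
    rw [heq] at hne ⊢
    obtain ⟨h1, h2⟩ := ih hTΛ.2 (hne.mono Set.inter_subset_left)
    refine ⟨(hΛ.inter _ h1 _ hTΛ.1).resolve_right hne.ne_empty, fun y hy hyc => ?_⟩
    rw [(hΛ.clean _ h1 _ hTΛ.1 hne).conormalSpace_eq hy hyc, h2 y hy.1 hyc, iSup_insert, sup_assoc,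
      sup_comm (conormalSpace B y)]

/-- Non-empty intersections of members of a simple arrangement are members, and their conormal
space is the sum of the conormal spaces. -/
lemma IsSimpleArrangement.sInter {U : X.Opens} {Λ : Set (Set X)}
    (hΛ : IsSimpleArrangement U Λ) {T : Set (Set X)} (hTΛ : T ⊆ Λ) (hTne : T.Nonempty)
    (hne : (⋂₀ T).Nonempty) :
    ⋂₀ T ∈ Λ ∧ ∀ y ∈ ⋂₀ T, IsClosed ({y} : Set X) →
      conormalSpace (⋂₀ T) y = ⨆ B ∈ T, conormalSpace B y := by
  obtain ⟨A, hA⟩ := hTne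
  have heq : A ∩ ⋂₀ T = ⋂₀ T := Set.inter_eq_right.2 (Set.sInter_subset_of_mem hA)
  have := hΛ.inter_sInter (hΛ.finite.subset hTΛ) hTΛ (hTΛ hA) (by rwa [heq])
  rw [heq] at this
  refine ⟨this.1, fun y hy hyc => ?_⟩
  rw [this.2 y hy hyc]
  exact sup_eq_right.2 (le_iSup₂_of_le A hA le_rfl)

/-- Intersecting with one more member splits each piece within itself, so pieces from different
parents stay disjoint. -/
lemma IsArrangement.exists_disjoint_sUnion {U : X.Opens} {Λ : Set (Set X)}
    (hΛ : IsArrangement U Λ) {H : Set (Set X)} (hH : H.Finite) (hHΛ : H ⊆ Λ) {A : Set X}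
    (hA : A ∈ Λ) : ∃ T ⊆ Λ, T.PairwiseDisjoint id ∧ A ∩ ⋂₀ H = ⋃₀ T := by
  induction H, hH using Set.Finite.induction_on with
  | empty => exact ⟨{A}, by simpa using hA, by simp, by simp⟩
  | @insert B H _ _ ih =>
    rw [Set.insert_subset_iff] at hHΛ
    obtain ⟨T, hTΛ, hTd, hT⟩ := ih hHΛ.2
    have hex : ∀ t : T, ∃ T' ⊆ Λ, T'.PairwiseDisjoint id ∧ (t : Set X) ∩ B = ⋃₀ T' := by
      intro t
      rcases hΛ.inter _ (hTΛ t.2) _ hHΛ.1 with h | h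
      · exact h
      · exact ⟨∅, by simp, by simp, by simpa using h⟩
    choose T' hT'Λ hT'd hT' using hex
    have hsub : ∀ t : T, ∀ s ∈ T' t, s ⊆ t := fun t s hs =>
      (Set.subset_sUnion_of_mem hs).trans ((hT' t).symm.subset.trans Set.inter_subset_left)
    refine ⟨⋃ t, T' t, Set.iUnion_subset hT'Λ, ?_, ?_⟩
    · intro a ha b hb hab
      obtain ⟨s, hs⟩ := Set.mem_iUnion.1 ha
      obtain ⟨t, ht⟩ := Set.mem_iUnion.1 hb
      by_cases hst : s = t
      · subst hst
        exact hT'd s hs ht hab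
      · exact (hTd s.2 t.2 (fun h => hst (Subtype.ext h))).mono (hsub s a hs) (hsub t b ht)
    · have heq : A ∩ ⋂₀ insert B H = (A ∩ ⋂₀ H) ∩ B := by
        rw [Set.sInter_insert]
        ac_rfl
      rw [heq, hT, Set.sUnion_iUnion, Set.sUnion_eq_iUnion, Set.iUnion_inter]
      exact Set.iUnion_congr hT'

/-- A connected intersection of members of an arrangement is a member. -/
lemma IsArrangement.sInter_mem {Λ : Set (Set X)} (hΛ : IsArrangement ⊤ Λ) {H : Set (Set X)}
    (hHΛ : H ⊆ Λ) (hHne : H.Nonempty) (hc : _root_.IsConnected (⋂₀ H)) : ⋂₀ H ∈ Λ := by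
  obtain ⟨A, hA⟩ := hHne
  obtain ⟨T, hTΛ, hTd, hT⟩ := hΛ.exists_disjoint_sUnion (hΛ.finite.subset hHΛ) hHΛ (hHΛ hA)
  rw [Set.inter_eq_right.2 (Set.sInter_subset_of_mem hA)] at hT
  rw [hT] at hc ⊢
  obtain ⟨x, t, ht, hxt⟩ := hc.nonempty
  have hcl : IsClosed (⋃₀ (T \ {t})) := by
    rw [Set.sUnion_eq_biUnion]
    exact (hΛ.finite.subset (Set.sdiff_subset.trans hTΛ)).isClosed_biUnion
      fun s hs => (hΛ.mem s (hTΛ hs.1)).isClosed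
  have hdisj : ∀ z ∈ t, z ∉ ⋃₀ (T \ {t}) := by
    rintro z hz ⟨s, ⟨hs, hst⟩, hzs⟩
    exact Set.disjoint_left.1 (hTd hs ht hst) hzs hz
  have hcov : ⋃₀ T ⊆ t ∪ ⋃₀ (T \ {t}) := by
    rintro z ⟨s, hs, hzs⟩
    by_cases hst : s = t
    · exact Or.inl (hst ▸ hzs)
    · exact Or.inr ⟨s, ⟨hs, hst⟩, hzs⟩
  rcases (isPreconnected_iff_subset_of_disjoint_closed.1 hc.isPreconnected) t _
    (hΛ.mem t (hTΛ ht)).isClosed hcl hcov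
    (Set.eq_empty_iff_forall_notMem.2 fun z hz => hdisj z hz.2.1 hz.2.2) with h | h
  · rw [h.antisymm (Set.subset_sUnion_of_mem ht)]
    exact hTΛ ht
  · exact absurd (h ⟨t, ht, hxt⟩) (hdisj x hxt)

/-! ### Restriction to open sets -/

lemma inter_mem_restr {P : Set (Set X)} {A : Set X} {U : X.Opens} (hA : A ∈ P)
    (hne : (A ∩ U).Nonempty) : A ∩ U ∈ restr P U := ⟨A, hA, hne, rfl⟩

lemma restr_mono {P Q : Set (Set X)} (h : P ⊆ Q) (U : X.Opens) : restr P U ⊆ restr Q U := by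
  rintro _ ⟨A, hA, hne, rfl⟩
  exact inter_mem_restr (h hA) hne

lemma sInter_restr {H : Set (Set X)} {U : X.Opens} (hne : H.Nonempty)
    (hH : ∀ A ∈ H, (A ∩ U).Nonempty) : ⋂₀ restr H U = ⋂₀ H ∩ U := by
  ext x
  constructor
  · intro hx
    have key : ∀ A ∈ H, x ∈ A ∩ U := fun A hA => hx _ (inter_mem_restr hA (hH A hA))
    obtain ⟨A, hA⟩ := hne
    exact ⟨fun B hB => (key B hB).1, (key A hA).2⟩
  · rintro ⟨hx, hxU⟩ _ ⟨A, hA, -, rfl⟩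
    exact ⟨hx A hA, hxU⟩

lemma subset_of_inter_open_subset {A B : Set X} {U : X.Opens} (hA : IsIrreducible A)
    (hB : IsClosed B) (hne : (A ∩ U).Nonempty) (h : A ∩ U ⊆ B ∩ U) : A ⊆ B :=
  hA.subset_of_inter_subset hB U.2 hne (h.trans Set.inter_subset_left)

lemma eq_of_inter_open_eq {A B : Set X} {U : X.Opens} (hA : IsIrreducible A) (hA' : IsClosed A)
    (hB : IsIrreducible B) (hB' : IsClosed B) (hne : (A ∩ U).Nonempty)
    (h : A ∩ U = B ∩ U) : A = B :=
  (subset_of_inter_open_subset hA hB' hne h.subset).antisymm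
    (subset_of_inter_open_subset hB hA' (h ▸ hne) h.symm.subset)

lemma subset_of_restr_subset {P Q : Set (Set X)} {U : X.Opens}
    (hP : ∀ A ∈ P, IsClosed A ∧ IsIrreducible A ∧ (A ∩ U).Nonempty)
    (hQ : ∀ A ∈ Q, IsClosed A ∧ IsIrreducible A) (h : restr P U ⊆ restr Q U) : P ⊆ Q := by
  intro A hA
  obtain ⟨hcl, hi, hne⟩ := hP A hA
  obtain ⟨B, hB, -, hAB⟩ := h (inter_mem_restr hA hne)
  rw [eq_of_inter_open_eq hi hcl (hQ B hB).2 (hQ B hB).1 hne hAB]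
  exact hB

/-- Taking factors commutes with the restriction to open sets. -/
lemma factors_restr {𝒢 : Set (Set X)} (h𝒢 : ∀ G ∈ 𝒢, IsClosed G ∧ IsIrreducible G) {D : Set X}
    (hD : IsIrreducible D) {U : X.Opens} (hne : (D ∩ U).Nonempty) :
    factors (restr 𝒢 U) (D ∩ U) = restr (factors 𝒢 D) U := by
  have hsub : ∀ G ∈ 𝒢, D ∩ U ⊆ G ∩ U → D ⊆ G := fun G hG h =>
    subset_of_inter_open_subset hD (h𝒢 G hG).1 hne h
  have hmono : ∀ {G : Set X}, D ⊆ G → D ∩ U ⊆ G ∩ U := fun h => Set.inter_subset_inter_left _ h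
  ext M
  constructor
  · rintro ⟨⟨⟨G, hG, hGne, rfl⟩, hDG⟩, hmin⟩
    refine ⟨G, ⟨⟨hG, hsub G hG hDG⟩, fun G' hG' hle => ?_⟩, hGne, rfl⟩
    have hne' : (G' ∩ U).Nonempty := hne.mono (hmono hG'.2)
    exact subset_of_inter_open_subset (h𝒢 G hG).2 (h𝒢 G' hG'.1).1 hGne
      (hmin ⟨inter_mem_restr hG'.1 hne', hmono hG'.2⟩ (Set.inter_subset_inter_left _ hle))
  · rintro ⟨G, ⟨⟨hG, hDG⟩, hmin⟩, hGne, rfl⟩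
    refine ⟨⟨inter_mem_restr hG hGne, hmono hDG⟩, ?_⟩
    rintro _ ⟨⟨G', hG', hG'ne, rfl⟩, hDG'⟩ hle
    exact Set.inter_subset_inter_left _ (hmin ⟨hG', hsub G' hG' hDG'⟩
      (subset_of_inter_open_subset (h𝒢 G' hG').2 (h𝒢 G hG).1 hG'ne hle))

lemma exists_mem_cover {𝒰 : Set X.Opens} (h : sSup 𝒰 = ⊤) (x : X) : ∃ U ∈ 𝒰, x ∈ U := by
  have : x ∈ sSup 𝒰 := h ▸ Opens.mem_top x
  simpa [Opens.mem_sSup] using this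

/-! ### Nested sets and the intersection criterion -/

section Nested

variable {Λ 𝒢 : Set (Set X)}

/-- Members of a nested set satisfy the intersection criterion. -/
theorem IsNested.inter_criterion (hΛ : IsArrangement ⊤ Λ) (hΛi : ∀ L ∈ Λ, IsIrreducible L)
    (h𝒢 : 𝒢 ⊆ Λ) (hwc : IsWellConnected 𝒢) {S : Set (Set X)} (hS : IsNested 𝒢 Λ S)
    {H : Set (Set X)} (hHS : H ⊆ S) (hanti : IsAntichain (· ⊆ ·) H) (hnt : H.Nontrivial) :
    (⋂₀ H).Nonempty ∧ _root_.IsConnected (⋂₀ H) ∧ IsTransversal H ∧ ⋂₀ H ∉ 𝒢 := by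
  obtain ⟨hS𝒢, 𝒰, ⟨hcov, h𝒰⟩, W, hW, hSW, -, hnest⟩ := hS
  have hH𝒢 : H ⊆ 𝒢 := hHS.trans hS𝒢
  have hHΛ : H ⊆ Λ := hH𝒢.trans h𝒢
  have hreg : ∀ A ∈ Λ, IsClosed A ∧ IsIrreducible A :=
    fun A hA => ⟨(hΛ.mem A hA).isClosed, hΛi A hA⟩
  have hHW : ∀ A ∈ H, (A ∩ W).Nonempty := fun A hA => hSW A (hHS hA)
  have hinj : ∀ A ∈ H, ∀ B ∈ H, A ∩ W = B ∩ W → A = B := fun A hA B hB h =>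
    eq_of_inter_open_eq (hreg A (hHΛ hA)).2 (hreg A (hHΛ hA)).1 (hreg B (hHΛ hB)).2
      (hreg B (hHΛ hB)).1 (hHW A hA) h
  have hantiW : IsAntichain (· ⊆ ·) (restr H W) := by
    rintro _ ⟨A, hA, hAne, rfl⟩ _ ⟨B, hB, -, rfl⟩ hne hle
    refine hanti hA hB (fun h => hne (h ▸ rfl)) ?_
    exact subset_of_inter_open_subset (hreg A (hHΛ hA)).2 (hreg B (hHΛ hB)).1 hAne hle
  have hntW : (restr H W).Nontrivial := by
    obtain ⟨A, hA, B, hB, hAB⟩ := hnt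
    exact ⟨_, inter_mem_restr hA (hHW A hA), _, inter_mem_restr hB (hHW B hB),
      fun h => hAB (hinj A hA B hB h)⟩
  obtain ⟨L, hL, hLH⟩ := hnest _ (restr_mono hHS W) hantiW hntW
  have hLD : ⋂₀ H ∩ W = L := by
    rw [← sInter_restr hnt.nonempty hHW, ← hLH]
    exact ((h𝒰 W hW).2.2 L hL).2
  have hLc : _root_.IsConnected L := ((h𝒰 W hW).1.mem L hL.1).connected
  have hDW : (⋂₀ H ∩ W).Nonempty := hLD ▸ hLc.nonempty
  have hDne : (⋂₀ H).Nonempty := hDW.mono Set.inter_subset_left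
  have hD𝒢 : ⋂₀ H ∉ 𝒢 := fun h => hL.2 (hLD ▸ inter_mem_restr h hDW)
  have hDc : _root_.IsConnected (⋂₀ H) := by
    have hsub : (components (⋂₀ H)).Subsingleton := by
      rw [← Set.not_nontrivial_iff]
      intro hnt'
      obtain ⟨x, hx, hxW⟩ := hDW
      have hC : connectedComponentIn (⋂₀ H) x ∈ 𝒢 := hwc H hH𝒢 hnt' ⟨x, hx, rfl⟩
      have hLC : L ⊆ connectedComponentIn (⋂₀ H) x :=
        hLc.isPreconnected.subset_connectedComponentIn (hLD ▸ ⟨hx, hxW⟩)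
          (hLD ▸ Set.inter_subset_left)
      -- This trace would put `L` in `𝒢|_W`.
      have hCW : connectedComponentIn (⋂₀ H) x ∩ W = L := by
        refine Set.Subset.antisymm ?_ fun z hz => ⟨hLC hz, ?_⟩
        · rw [← hLD]
          exact Set.inter_subset_inter_left _ (connectedComponentIn_subset _ _)
        · rw [← hLD] at hz
          exact hz.2
      exact hL.2 (hCW ▸ inter_mem_restr hC (hCW ▸ hLc.nonempty))
    obtain ⟨x, hx⟩ := hDne
    have : ⋂₀ H = connectedComponentIn (⋂₀ H) x := by
      refine Set.Subset.antisymm (fun z hz => ?_) (connectedComponentIn_subset _ _)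
      rw [hsub ⟨x, hx, rfl⟩ ⟨z, hz, rfl⟩]
      exact mem_connectedComponentIn hz
    rw [this]
    exact isConnected_connectedComponentIn_iff.2 hx
  refine ⟨hDne, hDc, ?_, hD𝒢⟩
  have hDΛ : ⋂₀ H ∈ Λ := hΛ.sInter_mem hHΛ hnt.nonempty hDc
  have hreg𝒢 : ∀ A ∈ 𝒢, IsClosed A ∧ IsIrreducible A := fun A hA => hreg A (h𝒢 hA)
  have hfac : restr (factors 𝒢 (⋂₀ H)) W = restr H W := by
    rw [← factors_restr hreg𝒢 (hΛi _ hDΛ) hDW, hLD, hLH]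
  have hHfac : H ⊆ factors 𝒢 (⋂₀ H) := subset_of_restr_subset
    (fun A hA => ⟨(hreg A (hHΛ hA)).1, (hreg A (hHΛ hA)).2, hHW A hA⟩)
    (fun A hA => hreg𝒢 A hA.1.1) hfac.symm.subset
  intro y hy hyc
  -- The point `y` may lie outside `W`; the inclusion of `H` in the factors of `⋂₀ H` is global, so
  -- the building condition on another chart `U` serves.
  obtain ⟨U, hU, hyU⟩ := exists_mem_cover hcov y
  have hDU : (⋂₀ H ∩ U).Nonempty := ⟨y, hy, hyU⟩
  have hmem : ⋂₀ H ∩ U ∈ restr Λ U \ restr 𝒢 U := by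
    refine ⟨inter_mem_restr hDΛ hDU, ?_⟩
    rintro ⟨G, hG, -, hGD⟩
    rw [eq_of_inter_open_eq (hreg _ hDΛ).2 (hreg _ hDΛ).1 (hreg𝒢 G hG).2 (hreg𝒢 G hG).1 hDU hGD]
      at hD𝒢
    exact hD𝒢 hG
  obtain ⟨htr, hfacInter⟩ := (h𝒰 U hU).2.2 _ hmem
  have hind := htr y (by rw [hfacInter]; exact ⟨hy, hyU⟩) hyc
  have hmemF : ∀ A : H, (A : Set X) ∩ U ∈ factors (restr 𝒢 U) (⋂₀ H ∩ U) := fun A => by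
    rw [factors_restr hreg𝒢 (hΛi _ hDΛ) hDU]
    exact inter_mem_restr (hHfac A.2) ⟨y, hy A A.2, hyU⟩
  have hcomp := hind.comp (f := fun A : H => ⟨(A : Set X) ∩ U, hmemF A⟩) (fun A B hAB =>
    Subtype.ext (eq_of_inter_open_eq (hreg _ (hHΛ A.2)).2 (hreg _ (hHΛ A.2)).1
      (hreg _ (hHΛ B.2)).2 (hreg _ (hHΛ B.2)).1 ⟨y, hy A A.2, hyU⟩ (congrArg Subtype.val hAB)))
  convert hcomp using 2 with A
  exact (conormalSpace_inter_open _ U hyU).symm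

/-- The minimal members of `S` form an antichain, and every member contains one of them. -/
lemma exists_mem_sInter (hΛ : IsArrangement ⊤ Λ) [Nonempty X] {S : Set (Set X)} (hS : S ⊆ Λ)
    (h : ∀ H ⊆ S, IsAntichain (· ⊆ ·) H → H.Nontrivial → (⋂₀ H).Nonempty) :
    (⋂₀ S).Nonempty := by
  have hfin := hΛ.finite.subset hS
  let M : Set (Set X) := {A | Minimal (· ∈ S) A}
  have hMS : M ⊆ S := fun A hA => hA.1
  have hMne : (⋂₀ M).Nonempty := by
    rcases M.subsingleton_or_nontrivial with hM | hM
    · rcases M.eq_empty_or_nonempty with h0 | ⟨A, hA⟩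
      · rw [h0, Set.sInter_empty]
        exact Set.univ_nonempty
      · rw [hM.eq_singleton_of_mem hA, Set.sInter_singleton]
        exact (hΛ.mem A (hS (hMS hA))).connected.nonempty
    · exact h M hMS (fun A hA B hB hne hle => hne (hle.antisymm (hB.2 hA.1 hle))) hM
  obtain ⟨p, hp⟩ := hMne
  refine ⟨p, fun A hA => ?_⟩
  obtain ⟨B, hBA, hB⟩ := hfin.exists_le_minimal hA
  exact hBA (hp B hB)

/-- On a simple building set, an antichain no two or more of whose members intersect in an element
of the building set consists of the factors of its intersection. -/
lemma factors_sInter_eq [IsIntegral X] [JacobsonSpace X]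
    (hX : ∀ y : X, IsClosed ({y} : Set X) → IsRegularLocalRing (X.presheaf.stalk y))
    (hΛ : IsArrangement ⊤ Λ) (hΛi : ∀ L ∈ Λ, IsIrreducible L) {W : X.Opens}
    (hsimp : IsSimpleArrangement W (restr Λ W))
    (hbuild : IsSimpleBuilding (restr 𝒢 W) (restr Λ W)) {H : Set (Set X)} (hH : H ⊆ restr 𝒢 W)
    (hnt : H.Nontrivial) (hne : (⋂₀ H).Nonempty)
    (hK : ∀ K ⊆ H, K.Nontrivial → ⋂₀ K ∉ restr 𝒢 W) :
    factors (restr 𝒢 W) (⋂₀ H) = H := by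
  have hHΛ : H ⊆ restr Λ W := hH.trans hbuild.1
  have hLΛ := (hsimp.sInter hHΛ hnt.nonempty hne).1
  obtain ⟨htr, hfacInter⟩ := hbuild.2 _ ⟨hLΛ, hK H subset_rfl hnt⟩
  obtain ⟨y, hy, hyc⟩ : (⋂₀ H ∩ closedPoints X).Nonempty := by
    refine nonempty_inter_closedPoints hne ?_
    obtain ⟨C, hC, hCW⟩ := (hsimp.mem _ hLΛ).closed_in
    rw [hCW]
    exact hC.isLocallyClosed.inter W.2.isLocallyClosed
  have hind := htr y (hfacInter.symm ▸ hy) hyc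
  have hφ : ∀ h : H, ∃ f : factors (restr 𝒢 W) (⋂₀ H), (f : Set X) ⊆ h := by
    intro h
    have hfin : {G | G ∈ restr 𝒢 W ∧ ⋂₀ H ⊆ G}.Finite :=
      hsimp.finite.subset fun G hG => hbuild.1 hG.1
    obtain ⟨f, hfh, hf⟩ := hfin.exists_le_minimal
      (show (h : Set X) ∈ _ from ⟨hH h.2, Set.sInter_subset_of_mem h.2⟩)
    exact ⟨⟨f, hf⟩, hfh⟩
  choose φ hφ using hφ
  have hfib : ∀ f : factors (restr 𝒢 W) (⋂₀ H), ∃ h : H, (f : Set X) = h ∧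
      ∀ h', φ h' = f → h' = h := by
    intro f
    have hfΛ : (f : Set X) ∈ restr Λ W := hbuild.1 f.2.1.1
    have hyf : y ∈ (f : Set X) := f.2.1.2 hy
    have hle : conormalSpace (f : Set X) y ≤ ⨆ h : H, conormalSpace (h : Set X) y := by
      refine (conormalSpace_anti f.2.1.2 y).trans ?_
      rw [(hsimp.sInter hHΛ hnt.nonempty hne).2 y hy hyc, iSup_subtype']
    have hle' := hind.le_iSup_fiber φ (fun h => conormalSpace_anti (hφ h) y) hle
    let K : Set (Set X) := {h | ∃ h' : H, (h' : Set X) = h ∧ φ h' = f}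
    have hKH : K ⊆ H := by
      rintro _ ⟨h', rfl, -⟩
      exact h'.2
    obtain ⟨A, hA, hAne, hfA⟩ := hfΛ
    have hyA : y ∈ A ∩ W := hfA ▸ hyf
    have hAm := hΛ.mem A hA
    -- An empty fibre would make the conormal space of `f` zero, although `f` is a trace of a proper
    -- subvariety.
    have hKne : K.Nonempty := by
      by_contra hemp
      rw [Set.not_nonempty_iff_eq_empty] at hemp
      have hbot : conormalSpace (f : Set X) y = ⊥ := by
        refine le_bot_iff.1 (hle'.trans (iSup₂_le fun h hh => ?_))
        exact (Set.eq_empty_iff_forall_notMem.1 hemp h ⟨h, rfl, hh⟩).elim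
      rw [hfA, conormalSpace_inter_open _ W hyA.2] at hbot
      exact conormalSpace_ne_bot hX hyc hyA.1 hAm.isClosed hAm.nonsingular hAm.ne_univ hbot
    have hyK : y ∈ ⋂₀ K := Set.sInter_subset_sInter hKH hy
    obtain ⟨hKΛ, hKcon⟩ := hsimp.sInter (hKH.trans hHΛ) hKne ⟨y, hyK⟩
    have hfK : (f : Set X) = ⋂₀ K := by
      have hsub : (f : Set X) ⊆ ⋂₀ K := by
        rintro z hz _ ⟨h', rfl, hh'⟩
        exact hφ h' (hh' ▸ hz)
      have hcon : conormalSpace (f : Set X) y ≤ conormalSpace (⋂₀ K) y := by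
        rw [hKcon y hyK hyc]
        exact hle'.trans (iSup₂_le fun h hh => le_iSup₂_of_le (h : Set X) ⟨h, rfl, hh⟩ le_rfl)
      obtain ⟨B, hB, hBne, hKB⟩ := hKΛ
      have hyB : y ∈ B ∩ W := hKB ▸ hyK
      have hBm := hΛ.mem B hB
      rw [hfA, hKB] at hsub hcon ⊢
      rw [conormalSpace_inter_open _ W hyA.2, conormalSpace_inter_open _ W hyA.2] at hcon
      rw [eq_of_conormalSpace_le hyc hyA.1 (subset_of_inter_open_subset (hΛi A hA) hBm.isClosed
        hAne hsub) hAm.isClosed hBm.isClosed (hΛi B hB) hAm.nonsingular hBm.nonsingular hcon]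
    -- Otherwise `⋂₀ K = f` would be an intersection of several members of `H` lying in the building
    -- set.
    have hKsub : K.Subsingleton := by
      rw [← Set.not_nontrivial_iff]
      exact fun h => hK K hKH h (hfK ▸ f.2.1.1)
    obtain ⟨_, h, rfl, hh⟩ := hKne
    refine ⟨h, ?_, fun h' hh' => Subtype.ext (hKsub ⟨h', rfl, hh'⟩ ⟨h, rfl, hh⟩)⟩
    rw [hfK, hKsub.eq_singleton_of_mem ⟨h, rfl, hh⟩, Set.sInter_singleton]
  ext A
  constructor
  · intro hA
    obtain ⟨h, hAh, -⟩ := hfib ⟨A, hA⟩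
    exact (show A = h from hAh) ▸ h.2
  · intro hA
    obtain ⟨h, hAh, hh⟩ := hfib (φ ⟨A, hA⟩)
    have : A = φ ⟨A, hA⟩ := by rw [hAh, ← hh _ rfl]
    rw [this]
    exact (φ ⟨A, hA⟩).2

/-- The intersection criterion implies nestedness. -/
theorem isNested_of_inter_criterion [IsIntegral X] [JacobsonSpace X]
    (hX : ∀ y : X, IsClosed ({y} : Set X) → IsRegularLocalRing (X.presheaf.stalk y))
    (hΛ : IsArrangement ⊤ Λ) (hΛi : ∀ L ∈ Λ, IsIrreducible L) (hG : IsBuilding 𝒢 Λ)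
    {S : Set (Set X)} (hS : S ⊆ 𝒢)
    (h : ∀ H ⊆ S, IsAntichain (· ⊆ ·) H → H.Nontrivial →
      (⋂₀ H).Nonempty ∧ _root_.IsConnected (⋂₀ H) ∧ ⋂₀ H ∉ 𝒢) : IsNested 𝒢 Λ S := by
  obtain ⟨h𝒢, 𝒰, hcov, h𝒰⟩ := hG
  have hSΛ : S ⊆ Λ := hS.trans h𝒢
  obtain ⟨p, hp⟩ := exists_mem_sInter hΛ hSΛ fun H h1 h2 h3 => (h H h1 h2 h3).1
  obtain ⟨W, hW, hpW⟩ := exists_mem_cover hcov p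
  obtain ⟨hsimp, hbuild⟩ := h𝒰 W hW
  have hSW : ∀ A ∈ S, (A ∩ W).Nonempty := fun A hA => ⟨p, hp A hA, hpW⟩
  refine ⟨hS, 𝒰, ⟨hcov, h𝒰⟩, W, hW, hSW, restr_mono hS W, fun H hHS hanti hnt => ?_⟩
  have hH𝒢 : H ⊆ restr 𝒢 W := hHS.trans (restr_mono hS W)
  have hpH : p ∈ ⋂₀ H := by
    intro M hM
    obtain ⟨A, hA, -, rfl⟩ := hHS hM
    exact ⟨hp A hA, hpW⟩
  have hK : ∀ K ⊆ H, K.Nontrivial → ⋂₀ K ∉ restr 𝒢 W := by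
    rintro K hKH hKnt ⟨G, hG, hGne, hKG⟩
    -- `K` is lifted to an antichain of `S`, where the global criterion applies.
    let K' : Set (Set X) := {A ∈ S | A ∩ W ∈ K}
    have hK'S : K' ⊆ S := Set.sep_subset _ _
    have hres : restr K' W = K := by
      ext M
      constructor
      · rintro ⟨A, hA, -, rfl⟩
        exact hA.2
      · intro hM
        obtain ⟨A, hA, hAne, rfl⟩ := hHS (hKH hM)
        exact ⟨A, ⟨hA, hM⟩, hAne, rfl⟩
    have hK'nt : K'.Nontrivial := by
      rw [← hres] at hKnt
      obtain ⟨_, ⟨A, hA, -, rfl⟩, _, ⟨B, hB, -, rfl⟩, hAB⟩ := hKnt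
      exact ⟨A, hA, B, hB, fun h => hAB (h ▸ rfl)⟩
    have hK'anti : IsAntichain (· ⊆ ·) K' := by
      intro A hA B hB hne hle
      refine hanti (hKH hA.2) (hKH hB.2) (fun heq => hne ?_) (Set.inter_subset_inter_left _ hle)
      exact eq_of_inter_open_eq (hΛi A (hSΛ hA.1)) (hΛ.mem A (hSΛ hA.1)).isClosed
        (hΛi B (hSΛ hB.1)) (hΛ.mem B (hSΛ hB.1)).isClosed (hSW A hA.1) heq
    obtain ⟨-, hc, hnot⟩ := h K' hK'S hK'anti hK'nt
    have hmem := hΛ.sInter_mem (hK'S.trans hSΛ) hK'nt.nonempty hc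
    rw [← hres, sInter_restr hK'nt.nonempty fun A hA => hSW A hA.1] at hKG
    rw [eq_of_inter_open_eq (hΛi _ hmem) (hΛ.mem _ hmem).isClosed (hΛi G (h𝒢 hG))
      (hΛ.mem G (h𝒢 hG)).isClosed (hKG ▸ hGne) hKG] at hnot
    exact hnot hG
  exact ⟨⋂₀ H, ⟨(hsimp.sInter (hH𝒢.trans hbuild.1) hnt.nonempty ⟨p, hpH⟩).1,
    hK H subset_rfl hnt⟩, factors_sInter_eq hX hΛ hΛi hsimp hbuild hH𝒢 hnt ⟨p, hpH⟩ hK⟩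

end Nested

end WonderfulArr

theorem mainTheorem2 {k : Type u} [Field k] [IsAlgClosed k] (X : Scheme.{u})
    (f : X ⟶ Spec (CommRingCat.of k)) [IsIntegral X] [IsSeparated f] [LocallyOfFiniteType f]
    [QuasiCompact f]
    (hX : ∀ y : X, IsClosed ({y} : Set X) → IsRegularLocalRing (X.presheaf.stalk y))
    (Λ 𝒢 : Set (Set X)) (hΛ : WonderfulArr.IsArrangement ⊤ Λ) (hG : WonderfulArr.IsBuilding 𝒢 Λ)
    (hwc : WonderfulArr.IsWellConnected 𝒢) (S : Set (Set X)) (hS : S ⊆ 𝒢) :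
    WonderfulArr.IsNested 𝒢 Λ S ↔
      ∀ H ⊆ S, IsAntichain (· ⊆ ·) H → H.Nontrivial →
        (⋂₀ H).Nonempty ∧ _root_.IsConnected (⋂₀ H) ∧ WonderfulArr.IsTransversal H ∧ ⋂₀ H ∉ 𝒢 := by
  have : JacobsonSpace X := LocallyOfFiniteType.jacobsonSpace f
  have : IsLocallyNoetherian X := LocallyOfFiniteType.isLocallyNoetherian f
  have : CompactSpace X := QuasiCompact.compactSpace_of_compactSpace f
  have : IsNoetherian X := {}
  have hΛi : ∀ L ∈ Λ, IsIrreducible L := fun L hL =>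
    (hΛ.mem L hL).nonsingular.isIrreducible (hΛ.mem L hL).isClosed (hΛ.mem L hL).connected
  constructor
  · intro h H hHS hanti hnt
    exact h.inter_criterion hΛ hΛi hG.1 hwc hHS hanti hnt
  · intro h
    refine WonderfulArr.isNested_of_inter_criterion hX hΛ hΛi hG hS fun H h1 h2 h3 => ?_
    obtain ⟨a, b, -, d⟩ := h H h1 h2 h3
    exact ⟨a, b, d⟩
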